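/- Let $\mathbb D=\{z\in\mathbb C:|z|<1\}$ and $\mathbb T=\{z\in\mathbb C:|z|=1\}$. For an integer $n\ge 0$, a finite Blaschke product of order $n$ is a function of the form $$B(z)=e^{i\alpha}\prod_{k=1}^{n}\frac{z_k-z}{1-\overline{z_k}\,z},\qquad \alpha\in\mathbb R,\quad z_1,\dots,z_n\in\mathbb D,$$ where the points $z_k$ need not be distinct (for $n=0$, $B$ is a unimodular constant). Theorem (Challener–Rubel; converse of the generalized Rouché theorem). Suppose that $f$ and $g$ are analytic on $|z|<R$ for some $R>1$ and that they have no zeros on $\mathbb T$. If $f$ and $g$ have the same number of zeros in $\mathbb D$, counted with multiplicity, then there are finite Blaschke products $B_1$ and $B_2$ of the same order such that $$|B_1(\zeta)f(\zeta)+B_2(\zeta)g(\zeta)|<|f(\zeta)|+|g(\zeta)|\qquad\text{for all }\zeta\in\mathbb T.$$ -/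

import Mathlib

open Metric

/-- `B` is a finite Blaschke product of order `n`: there are a real number `α` and points
`a 0, …, a (n - 1)` of the open unit disk (repetitions allowed) such that
`B z = e^{iα} ∏ k, (a k - z) / (1 - conj (a k) * z)`. The case `n = 0` is a unimodular constant.
All the poles `1 / conj (a k)` lie outside the closed unit disk. -/
def IsFiniteBlaschkeProduct (n : ℕ) (B : ℂ → ℂ) : Prop :=
  ∃ (α : ℝ) (a : Fin n → ℂ), (∀ k, a k ∈ ball (0 : ℂ) 1) ∧
    B = fun z => Complex.exp (α * Complex.I) *
      ∏ k, (a k - z) / (1 - (starRingEnd ℂ) (a k) * z)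

/-- The number of zeros of `f` in `U`, counted with multiplicity. It is meaningful when `f` is
analytic at the points of `U`, vanishes to finite order at each of them, and has only finitely
many zeros in `U`. This holds in particular when `U` is the open unit disk and `f` is analytic on
a larger concentric disk without zeros on the unit circle. -/
noncomputable def zeroCount (f : ℂ → ℂ) (U : Set ℂ) : ℕ :=
  ∑ᶠ z ∈ U, analyticOrderNatAt f z

/-!
The inequality at `ζ` says that `B₁ ζ * f ζ` and `B₂ ζ * g ζ` do not point in the same direction.
Dividing out the zeros in the disk by Blaschke factors gives `f = Bf * F` and `g = Bg * G` on the
circle, with `F`, `G` analytic and zero-free on the closed disk, and with `Bf`, `Bg` of the same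
order because the zero counts agree (`exists_blaschke_factorization`).

On a slightly larger disk `F / G` has an analytic square root `k`, and a partial sum `P` of its
Taylor series satisfies `‖P - k‖ < ‖k‖` on the closed disk (`exists_polynomial_close`,
`exists_analytic_sq_root`). In particular `P` is zero-free there, so with `n = deg P` the function
`ζ ^ n * conj (P ζ) / P ζ` on the circle is a finite Blaschke product `C` of order exactly `n`
(`exists_blaschke_of_polynomial`). Take `B₁ = Bg * C` and `B₂ z = -Bf z * z ^ n`, both of order
`deg Bf + n`. Up to the common factor `Bf * Bg`, the sum `B₁ * f + B₂ * g` on the circle is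
`ζ ^ n * G * (conj P * k ^ 2 / P - 1)`, and `conj P * k ^ 2 / P` is the square of `conj P * k`
divided by `‖P‖ ^ 2`. As `‖P - k‖ < ‖k‖` forces `0 < re (conj P * k)`, this number does not lie in
`(-∞, 0]`, so the triangle inequality is strict.
-/

/-! ### Products of finite Blaschke products -/

lemma isFiniteBlaschkeProduct_const (α : ℝ) :
    IsFiniteBlaschkeProduct 0 (fun _ => Complex.exp (α * Complex.I)) :=
  ⟨α, Fin.elim0, fun k => k.elim0, by simp⟩

lemma isFiniteBlaschkeProduct_one : IsFiniteBlaschkeProduct 0 (fun _ => 1) := by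
  simpa using isFiniteBlaschkeProduct_const 0

lemma isFiniteBlaschkeProduct_const_of_norm_eq_one {c : ℂ} (hc : ‖c‖ = 1) :
    IsFiniteBlaschkeProduct 0 (fun _ => c) := by
  have h := isFiniteBlaschkeProduct_const c.arg
  have h' : Complex.exp (c.arg * Complex.I) = c := by
    have := Complex.norm_mul_exp_arg_mul_I c
    simpa [hc] using this
  rwa [h'] at h

lemma isFiniteBlaschkeProduct_factor {a : ℂ} (ha : a ∈ ball (0 : ℂ) 1) :
    IsFiniteBlaschkeProduct 1 (fun z => (a - z) / (1 - (starRingEnd ℂ) a * z)) :=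
  ⟨0, fun _ => a, fun _ => ha, by simp⟩

lemma IsFiniteBlaschkeProduct.mul {m n : ℕ} {A B : ℂ → ℂ} (hA : IsFiniteBlaschkeProduct m A)
    (hB : IsFiniteBlaschkeProduct n B) :
    IsFiniteBlaschkeProduct (m + n) (fun z => A z * B z) := by
  obtain ⟨α, a, ha, rfl⟩ := hA
  obtain ⟨β, b, hb, rfl⟩ := hB
  refine ⟨α + β, Fin.append a b, fun k => ?_, ?_⟩
  · refine Fin.addCases (fun i => ?_) (fun i => ?_) k
    · simpa using ha i
    · simpa using hb i
  · funext z
    rw [Fin.prod_univ_add]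
    simp only [Fin.append_left, Fin.append_right]
    push_cast
    rw [add_mul, Complex.exp_add]
    ring

lemma IsFiniteBlaschkeProduct.const_mul {n : ℕ} {B : ℂ → ℂ} (hB : IsFiniteBlaschkeProduct n B)
    {c : ℂ} (hc : ‖c‖ = 1) : IsFiniteBlaschkeProduct n (fun z => c * B z) := by
  simpa using (isFiniteBlaschkeProduct_const_of_norm_eq_one hc).mul hB

lemma IsFiniteBlaschkeProduct.pow {n : ℕ} {B : ℂ → ℂ} (hB : IsFiniteBlaschkeProduct n B) (m : ℕ) :
    IsFiniteBlaschkeProduct (m * n) (fun z => B z ^ m) := by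
  induction m with
  | zero => simpa using isFiniteBlaschkeProduct_one
  | succ m ih => simpa [pow_succ, Nat.succ_mul] using ih.mul hB

lemma IsFiniteBlaschkeProduct.prod {ι : Type*} (s : Finset ι) {n : ι → ℕ} {B : ι → ℂ → ℂ}
    (hB : ∀ i ∈ s, IsFiniteBlaschkeProduct (n i) (B i)) :
    IsFiniteBlaschkeProduct (∑ i ∈ s, n i) (fun z => ∏ i ∈ s, B i z) := by
  classical
  induction s using Finset.induction_on with
  | empty => simpa using isFiniteBlaschkeProduct_one
  | insert i s hi ih =>
    simp only [Finset.sum_insert hi, Finset.prod_insert hi]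
    exact (hB i (by simp)).mul (ih fun j hj => hB j (by simp [hj]))

lemma isFiniteBlaschkeProduct_pow (n : ℕ) : IsFiniteBlaschkeProduct n (fun z => z ^ n) := by
  have h := (((isFiniteBlaschkeProduct_factor (a := 0) (by simp)).const_mul
    (c := -1) (by simp)).pow n)
  simpa using h

lemma one_sub_conj_mul_ne_zero {a z : ℂ} (ha : a ∈ ball (0 : ℂ) 1)
    (hz : z ∈ closedBall (0 : ℂ) 1) : 1 - (starRingEnd ℂ) a * z ≠ 0 := by
  rw [mem_ball_zero_iff] at ha
  rw [mem_closedBall_zero_iff] at hz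
  intro h
  have h1 : ‖(starRingEnd ℂ) a * z‖ = 1 := by rw [← sub_eq_zero.mp h, norm_one]
  rw [norm_mul, RCLike.norm_conj] at h1
  nlinarith [norm_nonneg a, norm_nonneg z]

lemma mul_conj_eq_one_of_mem_sphere {z : ℂ} (hz : z ∈ sphere (0 : ℂ) 1) :
    z * (starRingEnd ℂ) z = 1 := by
  rw [mem_sphere_zero_iff_norm] at hz
  rw [Complex.mul_conj, Complex.normSq_eq_norm_sq, hz]
  simp

lemma IsFiniteBlaschkeProduct.norm_eq_one {n : ℕ} {B : ℂ → ℂ} (hB : IsFiniteBlaschkeProduct n B)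
    {z : ℂ} (hz : z ∈ sphere (0 : ℂ) 1) : ‖B z‖ = 1 := by
  obtain ⟨α, a, ha, rfl⟩ := hB
  have hzz := mul_conj_eq_one_of_mem_sphere hz
  simp only [norm_mul, Complex.norm_exp_ofReal_mul_I, norm_prod, one_mul]
  refine Finset.prod_eq_one fun k _ => ?_
  have h1 : a k - z = -z * (starRingEnd ℂ) (1 - (starRingEnd ℂ) (a k) * z) := by
    simp only [map_sub, map_mul, map_one, Complex.conj_conj]
    linear_combination -(a k) * hzz
  have h2 := one_sub_conj_mul_ne_zero (ha k) (sphere_subset_closedBall hz)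
  rw [norm_div, h1, norm_mul, RCLike.norm_conj, norm_neg, mem_sphere_zero_iff_norm.mp hz, one_mul,
    div_self (norm_ne_zero_iff.mpr h2)]

/-! ### Dividing out the zeros in the disk -/

lemma preperfect_closedBall_zero_one : Preperfect (closedBall (0 : ℂ) 1) :=
  IsPreconnected.preperfect_of_nontrivial
    ⟨0, by simp, 1, by simp, zero_ne_one⟩ (convex_closedBall 0 1).isPreconnected

/-- An analytic function on the closed unit disk without zeros on the circle agrees on the circle
with a finite Blaschke product, whose order is the number of zeros of the function in the disk,
times an analytic function without zeros on the closed disk. -/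
lemma exists_blaschke_factorization {f : ℂ → ℂ} (hf : AnalyticOnNhd ℂ f (closedBall 0 1))
    (hf0 : ∀ ζ ∈ sphere (0 : ℂ) 1, f ζ ≠ 0) :
    ∃ B F : ℂ → ℂ, IsFiniteBlaschkeProduct (zeroCount f (ball 0 1)) B ∧
      AnalyticOnNhd ℂ F (closedBall 0 1) ∧ (∀ z ∈ closedBall (0 : ℂ) 1, F z ≠ 0) ∧
      ∀ ζ ∈ sphere (0 : ℂ) 1, f ζ = B ζ * F ζ := by
  have h1 : (1 : ℂ) ∈ sphere (0 : ℂ) 1 := by simp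
  have hord : ∀ z ∈ closedBall (0 : ℂ) 1, analyticOrderAt f z ≠ ⊤ := fun z hz =>
    hf.analyticOrderAt_ne_top_of_isPreconnected (convex_closedBall 0 1).isPreconnected
      (sphere_subset_closedBall h1) hz
      (by rw [(hf 1 (sphere_subset_closedBall h1)).analyticOrderAt_eq_zero.mpr (hf0 1 h1)]; simp)
  -- The divisor of `f` is finitely supported and records `analyticOrderNatAt f`.
  set D := MeromorphicOn.divisor f (closedBall 0 1) with hD
  have hDfin : D.support.Finite := D.finiteSupport (isCompact_closedBall 0 1)
  have hDm : ∀ z ∈ closedBall (0 : ℂ) 1, D z = (analyticOrderNatAt f z : ℤ) := fun z hz => by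
    rw [hD, MeromorphicOn.AnalyticOnNhd.divisor_apply hf hz,
      ← Nat.cast_analyticOrderNatAt (hord z hz)]
    simp
  set S := hDfin.toFinset with hS
  have hSball : ∀ u ∈ S, u ∈ ball (0 : ℂ) 1 := fun u hu => by
    have hu' : D u ≠ 0 := by simpa [hS] using hu
    have huc : u ∈ closedBall (0 : ℂ) 1 := D.supportWithinDomain hu'
    by_contra hub
    have hus : u ∈ sphere (0 : ℂ) 1 := by
      rw [mem_sphere_zero_iff_norm]
      rw [mem_closedBall_zero_iff] at huc
      rw [mem_ball_zero_iff, not_lt] at hub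
      exact le_antisymm huc hub
    apply hu'
    rw [hDm u huc, analyticOrderNatAt, (hf u huc).analyticOrderAt_eq_zero.mpr (hf0 u hus)]
    simp
  have hcount : zeroCount f (ball 0 1) = ∑ u ∈ S, analyticOrderNatAt f u := by
    refine finsum_mem_eq_sum_of_inter_support_eq _ ?_
    ext u
    simp only [Set.mem_inter_iff, Function.mem_support, Finset.mem_coe]
    refine ⟨fun h => ⟨?_, h.2⟩, fun h => ⟨hSball u h.1, h.2⟩⟩
    have h3 := hDm u (ball_subset_closedBall h.1)
    rw [hS, Set.Finite.mem_toFinset, Function.mem_support, h3]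
    exact_mod_cast h.2
  obtain ⟨g, hg, hg0, hfg⟩ := hf.meromorphicOn.extract_zeros_poles (fun u => by
    rw [(hf u u.2).meromorphicOrderAt_eq]
    simpa using hord u u.2) hDfin
  refine ⟨fun z => ∏ u ∈ S, ((u - z) / (1 - (starRingEnd ℂ) u * z)) ^ analyticOrderNatAt f u,
    fun z => (∏ u ∈ S, (-(1 - (starRingEnd ℂ) u * z)) ^ analyticOrderNatAt f u) * g z,
    ?_, ?_, ?_, ?_⟩
  · rw [hcount]
    refine IsFiniteBlaschkeProduct.prod S fun u hu => ?_
    simpa using (isFiniteBlaschkeProduct_factor (hSball u hu)).pow (analyticOrderNatAt f u)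
  · intro z hz
    have := hg z hz
    fun_prop
  · intro z hz
    refine mul_ne_zero (Finset.prod_ne_zero_iff.mpr fun u hu => pow_ne_zero _ ?_) (hg0 ⟨z, hz⟩)
    exact neg_ne_zero.mpr (one_sub_conj_mul_ne_zero (hSball u hu) hz)
  -- The factorization holds a priori only off a discrete set; continuity extends it to every point.
  · intro ζ hζ
    have hζc := sphere_subset_closedBall hζ
    have hDpos : 0 ≤ D ζ := by rw [hDm ζ hζc]; positivity
    have hφ : AnalyticAt ℂ (∏ᶠ u, (· - u) ^ D u) ζ :=
      Function.FactorizedRational.analyticAt hDpos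
    have hφg : AnalyticAt ℂ ((∏ᶠ u, (· - u) ^ D u) • g) ζ := hφ.smul (hg ζ hζc)
    have hev := (hf ζ hζc).meromorphicAt.eventuallyEq_nhdsNE_of_eventuallyEq_codiscreteWithin
      hφg.meromorphicAt hζc (preperfect_closedBall_zero_one ζ hζc) hfg
    have heq := (((hf ζ hζc).continuousAt.eventuallyEq_nhds_iff_eventuallyEq_nhdsNE
      hφg.continuousAt).mp hev).eq_of_nhds
    have hprod : (∏ᶠ u, (· - u) ^ D u : ℂ → ℂ) ζ
        = ∏ u ∈ S, (ζ - u) ^ analyticOrderNatAt f u := by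
      rw [finprod_eq_prod_of_mulSupport_subset (s := S), Finset.prod_apply]
      · refine Finset.prod_congr rfl fun u hu => ?_
        rw [Pi.pow_apply, hDm u (ball_subset_closedBall (hSball u hu)), zpow_natCast]
      · rw [Function.FactorizedRational.mulSupport]
        simp [hS]
    rw [heq, Pi.smul_apply', smul_eq_mul, hprod, ← mul_assoc, ← Finset.prod_mul_distrib]
    congr 1
    refine Finset.prod_congr rfl fun u hu => ?_
    rw [← mul_pow, mul_neg, div_mul_cancel₀ _ (one_sub_conj_mul_ne_zero (hSball u hu) hζc), neg_sub]

/-! ### Analytic square roots and polynomial approximation -/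

lemma exists_ball_subset_of_closedBall_subset {U : Set ℂ} (hU : IsOpen U)
    (h : closedBall (0 : ℂ) 1 ⊆ U) : ∃ r : ℝ, 1 < r ∧ ball (0 : ℂ) r ⊆ U := by
  obtain ⟨δ, hδ, hsub⟩ := (isCompact_closedBall (0 : ℂ) 1).exists_thickening_subset_open hU h
  rw [thickening_closedBall hδ zero_le_one] at hsub
  exact ⟨δ + 1, by linarith, hsub⟩

lemma exists_differentiableOn_ball_of_analyticOnNhd {h : ℂ → ℂ}
    (hh : AnalyticOnNhd ℂ h (closedBall 0 1)) (h0 : ∀ z ∈ closedBall (0 : ℂ) 1, h z ≠ 0) :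
    ∃ r : ℝ, 1 < r ∧ DifferentiableOn ℂ h (ball 0 r) ∧ ∀ z ∈ ball (0 : ℂ) r, h z ≠ 0 := by
  have hsub : closedBall (0 : ℂ) 1 ⊆ interior {z | AnalyticAt ℂ h z ∧ h z ≠ 0} := fun z hz =>
    mem_interior_iff_mem_nhds.mpr ((hh z hz).eventually_analyticAt.and
      ((hh z hz).continuousAt.eventually_ne (h0 z hz)))
  obtain ⟨r, hr, hrs⟩ := exists_ball_subset_of_closedBall_subset isOpen_interior hsub
  exact ⟨r, hr, fun z hz => (interior_subset (hrs hz)).1.differentiableAt.differentiableWithinAt,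
    fun z hz => (interior_subset (hrs hz)).2⟩

/-- A zero-free holomorphic function on a disk has a holomorphic square root, namely
`exp (φ / 2)` for a primitive `φ` of the logarithmic derivative, suitably normalized. -/
lemma exists_analytic_sq_root {h : ℂ → ℂ} {r : ℝ} (hr : 0 < r)
    (hh : DifferentiableOn ℂ h (ball 0 r)) (h0 : ∀ z ∈ ball (0 : ℂ) r, h z ≠ 0) :
    ∃ k : ℂ → ℂ, DifferentiableOn ℂ k (ball 0 r) ∧ ∀ z ∈ ball (0 : ℂ) r, h z = k z ^ 2 := by
  have hc : (0 : ℂ) ∈ ball (0 : ℂ) r := mem_ball_self hr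
  obtain ⟨φ, hφ0, hφ⟩ := ((hh.deriv isOpen_ball).div hh h0).isExactOn_ball.with_val_at 0
    (Complex.log (h 0))
  -- With `exp (φ 0) = h 0`, constancy of `h * exp (-φ)` gives `h = exp φ`.
  have hq : ∀ z ∈ ball (0 : ℂ) r, HasDerivAt (fun w => h w * Complex.exp (-φ w)) 0 z := by
    intro z hz
    have h1 := (hh.differentiableAt (isOpen_ball.mem_nhds hz)).hasDerivAt
    have h2 : HasDerivAt (fun w => h w * Complex.exp (-φ w)) (deriv h z * Complex.exp (-φ z) +
        h z * (Complex.exp (-φ z) * -(deriv h z / h z))) z := h1.mul (hφ z hz).neg.cexp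
    have h3 : deriv h z * Complex.exp (-φ z) +
        h z * (Complex.exp (-φ z) * -(deriv h z / h z)) = 0 := by
      have := h0 z hz
      field_simp
      ring
    rwa [h3] at h2
  refine ⟨fun z => Complex.exp (φ z / 2), fun z hz =>
    ((hφ z hz).differentiableAt.div_const 2).cexp.differentiableWithinAt, fun z hz => ?_⟩
  have hconst := isOpen_ball.is_const_of_deriv_eq_zero (convex_ball (0 : ℂ) r).isPreconnected
    (fun w hw => (hq w hw).differentiableAt.differentiableWithinAt)
    (fun w hw => (hq w hw).deriv) hz hc
  simp only [hφ0] at hconst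
  rw [Complex.exp_neg (Complex.log (h 0)), Complex.exp_log (h0 0 hc), mul_inv_cancel₀ (h0 0 hc),
    Complex.exp_neg, mul_inv_eq_one₀ (Complex.exp_ne_zero _)] at hconst
  rw [hconst, ← Complex.exp_nat_mul]
  congr 1
  push_cast
  ring

/-- A function holomorphic on a disk of radius greater than `1` is approximated uniformly on the
closed unit disk by the partial sums of its Taylor series. -/
lemma exists_polynomial_close {k : ℂ → ℂ} {r ε : ℝ} (hr : 1 < r) (hε : 0 < ε)
    (hk : DifferentiableOn ℂ k (ball 0 r)) :
    ∃ P : Polynomial ℂ, ∀ z ∈ closedBall (0 : ℂ) 1, ‖P.eval z - k z‖ < ε := by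
  obtain ⟨s, hs1, hsr⟩ := exists_between hr
  obtain ⟨t, ht1, hts⟩ := exists_between hs1
  lift s to NNReal using by linarith
  lift t to NNReal using by linarith
  have hps := (hk.mono (closedBall_subset_ball hsr)).hasFPowerSeriesOnBall
    (by exact_mod_cast (by linarith : (0 : ℝ) < s))
  have hu := hps.tendstoUniformlyOn (r' := t) (by exact_mod_cast hts)
  obtain ⟨n, hn⟩ := (Metric.tendstoUniformlyOn_iff.mp hu ε hε).exists
  refine ⟨∑ i ∈ Finset.range n,
    Polynomial.C ((cauchyPowerSeries k 0 s).coeff i) * Polynomial.X ^ i, fun z hz => ?_⟩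
  have h := hn z (closedBall_subset_ball ht1 hz)
  rw [dist_comm, dist_eq_norm, zero_add] at h
  have heval : (∑ i ∈ Finset.range n, Polynomial.C ((cauchyPowerSeries k 0 s).coeff i) *
      Polynomial.X ^ i).eval z = (cauchyPowerSeries k 0 s).partialSum n z := by
    rw [FormalMultilinearSeries.partialSum, Polynomial.eval_finsetSum]
    refine Finset.sum_congr rfl fun i _ => ?_
    rw [FormalMultilinearSeries.apply_eq_pow_smul_coeff, smul_eq_mul, Polynomial.eval_mul,
      Polynomial.eval_C, Polynomial.eval_pow, Polynomial.eval_X, mul_comm]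
  rwa [heval]

/-! ### Blaschke products from zero-free polynomials -/

/-- The case of a monic polynomial, given by its roots. -/
lemma exists_blaschke_of_multiset (s : Multiset ℂ) (hs : ∀ a ∈ s, a ∉ closedBall (0 : ℂ) 1) :
    ∃ C : ℂ → ℂ, IsFiniteBlaschkeProduct s.card C ∧ ∀ ζ ∈ sphere (0 : ℂ) 1,
      C ζ * (s.map fun a => ζ - a).prod =
        ζ ^ s.card * (starRingEnd ℂ) (s.map fun a => ζ - a).prod := by
  induction s using Multiset.induction_on with
  | empty => exact ⟨_, isFiniteBlaschkeProduct_one, by simp⟩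
  | cons a s ih =>
    obtain ⟨C, hC, hCs⟩ := ih fun b hb => hs b (Multiset.mem_cons_of_mem hb)
    have ha : 1 < ‖a‖ := by simpa using hs a (Multiset.mem_cons_self a s)
    have ha0 : a ≠ 0 := norm_pos_iff.mp (by linarith)
    have hac : (starRingEnd ℂ) a ≠ 0 := (map_ne_zero _).mpr ha0
    -- The zero of the factor is the reflection `1 / conj a` of `a` in the circle.
    have hb : ((starRingEnd ℂ) a)⁻¹ ∈ ball (0 : ℂ) 1 := by
      rw [mem_ball_zero_iff, norm_inv, RCLike.norm_conj]
      exact inv_lt_one_of_one_lt₀ ha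
    have hc : ‖-((starRingEnd ℂ) a / a)‖ = 1 := by
      rw [norm_neg, norm_div, RCLike.norm_conj, div_self (by positivity)]
    refine ⟨_, Multiset.card_cons a s ▸
      hC.mul ((isFiniteBlaschkeProduct_factor hb).const_mul hc), fun ζ hζ => ?_⟩
    have hζζ := mul_conj_eq_one_of_mem_sphere hζ
    have hden := one_sub_conj_mul_ne_zero hb (sphere_subset_closedBall hζ)
    have hfac : -((starRingEnd ℂ) a / a) * ((((starRingEnd ℂ) a)⁻¹ - ζ) /
        (1 - (starRingEnd ℂ) ((starRingEnd ℂ) a)⁻¹ * ζ)) * (ζ - a)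
          = ζ * (starRingEnd ℂ) (ζ - a) := by
      rw [map_inv₀, Complex.conj_conj] at hden ⊢
      have haζ : a - ζ ≠ 0 := fun h => hden (by
        rw [← sub_eq_zero.mp h, inv_mul_cancel₀ ha0, sub_self])
      rw [map_sub, mul_sub ζ, hζζ]
      field_simp
      ring
    rw [Multiset.map_cons, Multiset.prod_cons, map_mul, Multiset.card_cons, pow_succ]
    linear_combination (-((starRingEnd ℂ) a / a) * ((((starRingEnd ℂ) a)⁻¹ - ζ) /
        (1 - (starRingEnd ℂ) ((starRingEnd ℂ) a)⁻¹ * ζ)) * (ζ - a)) * hCs ζ hζ +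
      (ζ ^ s.card * (starRingEnd ℂ) (s.map fun a => ζ - a).prod) * hfac

/-- On the circle, the quotient of the reversed polynomial `z ^ n * conj (P (1 / conj z))` by `P`
is a Blaschke product whose zeros are the reflections of the roots of `P`. -/
lemma exists_blaschke_of_polynomial {P : Polynomial ℂ}
    (hP : ∀ z ∈ closedBall (0 : ℂ) 1, P.eval z ≠ 0) :
    ∃ (n : ℕ) (C : ℂ → ℂ), IsFiniteBlaschkeProduct n C ∧
      ∀ ζ ∈ sphere (0 : ℂ) 1, C ζ * P.eval ζ = ζ ^ n * (starRingEnd ℂ) (P.eval ζ) := by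
  have hP0 : P ≠ 0 := fun h => hP 0 (by simp) (by simp [h])
  obtain ⟨C, hC, hCP⟩ := exists_blaschke_of_multiset P.roots fun a ha hac =>
    hP a hac ((Polynomial.mem_roots hP0).mp ha)
  have hl : P.leadingCoeff ≠ 0 := Polynomial.leadingCoeff_ne_zero.mpr hP0
  have hc : ‖(starRingEnd ℂ) P.leadingCoeff / P.leadingCoeff‖ = 1 := by
    rw [norm_div, RCLike.norm_conj, div_self (norm_ne_zero_iff.mpr hl)]
  refine ⟨_, _, hC.const_mul hc, fun ζ hζ => ?_⟩
  have hcl : (starRingEnd ℂ) P.leadingCoeff / P.leadingCoeff * P.leadingCoeff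
      = (starRingEnd ℂ) P.leadingCoeff := div_mul_cancel₀ _ hl
  rw [(IsAlgClosed.splits P).eval_eq_prod_roots ζ, map_mul]
  linear_combination (C ζ * (P.roots.map fun a => ζ - a).prod) * hcl +
    (starRingEnd ℂ) P.leadingCoeff * hCP ζ hζ

/-! ### Strictness of the triangle inequality -/

/-- If `p` is closer to `k` than `0` is, then `conj p * k` has positive real part. -/
lemma re_conj_mul_pos {p k : ℂ} (h : ‖p - k‖ < ‖k‖) : 0 < ((starRingEnd ℂ) p * k).re := by
  have h2 : ‖p - k‖ ^ 2 < ‖k‖ ^ 2 := by gcongr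
  rw [← Complex.normSq_eq_norm_sq, ← Complex.normSq_eq_norm_sq] at h2
  simp only [Complex.normSq_apply, Complex.sub_re, Complex.sub_im] at h2
  simp only [Complex.mul_re, Complex.conj_re, Complex.conj_im]
  nlinarith [sq_nonneg p.re, sq_nonneg p.im]

lemma norm_sq_sub_ofReal_lt {v : ℂ} {s : ℝ} (hv : 0 < v.re) (hs : 0 < s) :
    ‖v ^ 2 - s‖ < ‖v‖ ^ 2 + s := by
  refine lt_of_pow_lt_pow_left₀ 2 (by positivity) ?_
  rw [← Complex.normSq_eq_norm_sq, ← Complex.normSq_eq_norm_sq]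
  simp only [Complex.normSq_apply, Complex.sub_re, Complex.sub_im, pow_two, Complex.mul_re,
    Complex.mul_im, Complex.ofReal_re, Complex.ofReal_im]
  nlinarith [mul_pos hs (mul_pos hv hv)]

/-- Here `C = ζ ^ n * conj p / p` for some `ζ` on the circle, `u = ζ ^ n`, and `F / G = k ^ 2`. -/
lemma norm_mul_sub_mul_lt {C u p k F G : ℂ} (hu : ‖u‖ = 1) (hG : G ≠ 0) (hF : F = k ^ 2 * G)
    (hC : C * p = u * (starRingEnd ℂ) p) (hpk : ‖p - k‖ < ‖k‖) :
    ‖C * F - u * G‖ < ‖F‖ + ‖G‖ := by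
  have hre := re_conj_mul_pos hpk
  have hp : p ≠ 0 := by
    rintro rfl
    simp at hpk
  have hp' : 0 < ‖p‖ := norm_pos_iff.mpr hp
  -- Clearing the denominator `p` turns the quotient `conj p * k ^ 2 / p` into a square.
  have hkey : (C * F - u * G) * p ^ 2 * (starRingEnd ℂ) p =
      u * p * G * (((starRingEnd ℂ) p * k) ^ 2 - ((‖p‖ ^ 2 : ℝ) : ℂ)) := by
    have hpp : ((‖p‖ ^ 2 : ℝ) : ℂ) = p * (starRingEnd ℂ) p := by
      rw [Complex.mul_conj, Complex.normSq_eq_norm_sq]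
    rw [hpp, hF]
    linear_combination (k ^ 2 * G * p * (starRingEnd ℂ) p) * hC
  have hlt := norm_sq_sub_ofReal_lt hre (pow_pos hp' 2)
  have hn := congrArg norm hkey
  simp only [norm_mul, norm_pow, RCLike.norm_conj, hu, one_mul] at hn hlt
  have hG' : 0 < ‖G‖ := norm_pos_iff.mpr hG
  rw [hF, norm_mul, norm_pow]
  have h3 : ‖C * F - u * G‖ * ‖p‖ ^ 3 < (‖k‖ ^ 2 * ‖G‖ + ‖G‖) * ‖p‖ ^ 3 := by
    calc ‖C * F - u * G‖ * ‖p‖ ^ 3 = ‖C * F - u * G‖ * ‖p‖ ^ 2 * ‖p‖ := by ring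
      _ = _ := hn
      _ < ‖p‖ * ‖G‖ * ((‖p‖ * ‖k‖) ^ 2 + ‖p‖ ^ 2) := by gcongr
      _ = _ := by ring
  rw [hF] at h3
  exact lt_of_mul_lt_mul_right h3 (by positivity)

theorem mainTheorem10 (R : ℝ) (hR : 1 < R) (f g : ℂ → ℂ)
    (hf : AnalyticOnNhd ℂ f (ball (0 : ℂ) R)) (hg : AnalyticOnNhd ℂ g (ball (0 : ℂ) R))
    (hf0 : ∀ ζ ∈ sphere (0 : ℂ) 1, f ζ ≠ 0) (hg0 : ∀ ζ ∈ sphere (0 : ℂ) 1, g ζ ≠ 0)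
    (hfg : zeroCount f (ball (0 : ℂ) 1) = zeroCount g (ball (0 : ℂ) 1)) :
    ∃ (n : ℕ) (B₁ B₂ : ℂ → ℂ),
      IsFiniteBlaschkeProduct n B₁ ∧ IsFiniteBlaschkeProduct n B₂ ∧
      ∀ ζ ∈ sphere (0 : ℂ) 1, ‖B₁ ζ * f ζ + B₂ ζ * g ζ‖ < ‖f ζ‖ + ‖g ζ‖ := by
  have hsub : closedBall (0 : ℂ) 1 ⊆ ball 0 R := closedBall_subset_ball hR
  obtain ⟨Bf, F, hBf, hF, hF0, hfF⟩ := exists_blaschke_factorization (hf.mono hsub) hf0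
  obtain ⟨Bg, G, hBg, hG, hG0, hgG⟩ := exists_blaschke_factorization (hg.mono hsub) hg0
  rw [← hfg] at hBg
  obtain ⟨r, hr, hd, hne⟩ := exists_differentiableOn_ball_of_analyticOnNhd (hF.div hG hG0)
    fun z hz => div_ne_zero (hF0 z hz) (hG0 z hz)
  obtain ⟨k, hk, hkh⟩ := exists_analytic_sq_root (by linarith) hd hne
  have hk0 : ∀ z ∈ closedBall (0 : ℂ) 1, k z ≠ 0 := fun z hz h => by
    have hz' := closedBall_subset_ball hr hz
    exact hne z hz' (by rw [hkh z hz', h]; simp)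
  -- The minimum of `‖k‖` on the closed disk is the required accuracy of the approximation.
  obtain ⟨z₀, hz₀, hmin⟩ := (isCompact_closedBall (0 : ℂ) 1).exists_isMinOn ⟨0, by simp⟩
    (hk.continuousOn.mono (closedBall_subset_ball hr)).norm
  obtain ⟨P, hP⟩ := exists_polynomial_close hr (norm_pos_iff.mpr (hk0 z₀ hz₀)) hk
  have hPk : ∀ z ∈ closedBall (0 : ℂ) 1, ‖P.eval z - k z‖ < ‖k z‖ := fun z hz =>
    (hP z hz).trans_le (hmin hz)
  obtain ⟨n, C, hC, hCP⟩ := exists_blaschke_of_polynomial (P := P) fun z hz h => by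
    have := hPk z hz
    simp [h] at this
  refine ⟨_, _, _, hBg.mul hC, (hBf.const_mul (c := -1) (by simp)).mul
    (isFiniteBlaschkeProduct_pow n), fun ζ hζ => ?_⟩
  have hζc := sphere_subset_closedBall hζ
  have hFG : F ζ = k ζ ^ 2 * G ζ := by
    rw [← hkh ζ (closedBall_subset_ball hr hζc), div_mul_cancel₀ _ (hG0 ζ hζc)]
  have hu : ‖ζ ^ n‖ = 1 := by rw [norm_pow, mem_sphere_zero_iff_norm.mp hζ, one_pow]
  have h := norm_mul_sub_mul_lt hu (hG0 ζ hζc) hFG (hCP ζ hζ) (hPk ζ hζc)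
  have hsum : Bg ζ * C ζ * f ζ + -1 * Bf ζ * ζ ^ n * g ζ
      = Bf ζ * Bg ζ * (C ζ * F ζ - ζ ^ n * G ζ) := by
    rw [hfF ζ hζ, hgG ζ hζ]
    ring
  rw [hsum, hfF ζ hζ, hgG ζ hζ]
  simpa [norm_mul, hBf.norm_eq_one hζ, hBg.norm_eq_one hζ] using h
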